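/- Theorem. Let $\lambda,\kappa\ge 0$ and $\gamma>0$, and let $(X_t,v_t)_{t\ge 0}$ be the Markov process on $\mathbb Z\times\{-1,1\}$ with generator $$Lf(x,v)=\lambda\big(f(x+v,v)-f(x,v)\big)+\kappa\big(f(x+1,v)+f(x-1,v)-2f(x,v)\big)+\gamma\big(f(x,-v)-f(x,v)\big),$$ acting on bounded functions, started from $X_0=0$ and $v_0=\pm1$ with probability $\tfrac12$ each. Put $$F(\alpha)=(2\kappa+\lambda)(\cosh\alpha-1)+\sqrt{\gamma^2+\lambda^2\sinh^2\alpha}-\gamma,\qquad I(x)=\sup_{\alpha\in\mathbb R}\big(\alpha x-F(\alpha)\big)\in[0,\infty].$$ (a) $X_t/t$ satisfies the large deviation principle with rate function $I$ as $t\to\infty$: $I$ is nonnegative and lower semicontinuous and, with $\log 0=-\infty$ and $\inf\emptyset=+\infty$, $$\limsup_{t\to\infty}\tfrac1t\log\mathbb P\big(\tfrac{X_t}{t}\in B\big)\le-\inf_{x\in B}I(x)\ \text{ for all closed } B\subset\mathbb R,\qquad \liminf_{t\to\infty}\tfrac1t\log\mathbb P\big(\tfrac{X_t}{t}\in G\big)\ge-\inf_{x\in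 G}I(x)\ \text{ for all open } G\subset\mathbb R.$$ (b) $F$ is the large deviation free energy of the position: for all $\alpha\in\mathbb R$, $\mathbb E(e^{\alpha X_t})<\infty$ for all $t\ge0$ and $\lim_{t\to\infty}\tfrac1t\log\mathbb E(e^{\alpha X_t})=F(\alpha)$. (c) For all $\alpha\in\mathbb R$, both eigenvalues of $M(-i\alpha)$ are real and $F(\alpha)$ is the largest one, where for $q\in\mathbb C$ $$M(q)=\begin{pmatrix}(2\kappa+\lambda)(\cos q-1)-\gamma+i\lambda\sin q&\gamma\\ \gamma&(2\kappa+\lambda)(\cos q-1)-\gamma-i\lambda\sin q\end{pmatrix}.$$ -/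

import Mathlib

open MeasureTheory ProbabilityTheory Filter Topology
open scoped NNReal ENNReal BoundedContinuousFunction

noncomputable section

namespace RunTumble

/-- The state space: a position in `ℤ` and a velocity in `ℤˣ = {1, -1}`. -/
abbrev State : Type := ℤ × ℤˣ

/-- The bounded operator `f ↦ f ∘ σ` on bounded functions on the (discrete) state space. -/
def pullback (σ : State → State) : (State →ᵇ ℝ) →L[ℝ] (State →ᵇ ℝ) :=
  LinearMap.mkContinuous
    { toFun := fun f => f.compContinuous ⟨σ, continuous_of_discreteTopology⟩
      map_add' := fun _ _ => rfl
      map_smul' := fun _ _ => rfl }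
    1
    (fun f => by
      rw [one_mul]
      exact (BoundedContinuousFunction.norm_le (norm_nonneg f)).2
        (fun p => f.norm_coe_le_norm (σ p)))

/-- The generator of the run-and-tumble particle, as a bounded operator on bounded functions:
with rate `lam` a jump in the direction of the velocity, with rate `κ` a jump to each of the two
neighbours, with rate `γ` a flip of the velocity. See `generator_apply`. -/
def generator (lam κ γ : ℝ) : (State →ᵇ ℝ) →L[ℝ] (State →ᵇ ℝ) :=
  lam • (pullback (fun p => (p.1 + (p.2 : ℤ), p.2)) - 1)
    + κ • (pullback (fun p => (p.1 + 1, p.2)) + pullback (fun p => (p.1 - 1, p.2)) - (2 : ℝ) • 1)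
    + γ • (pullback (fun p => (p.1, -p.2)) - 1)

theorem generator_apply (lam κ γ : ℝ) (f : State →ᵇ ℝ) (x : ℤ) (v : ℤˣ) :
    generator lam κ γ f (x, v)
      = lam * (f (x + (v : ℤ), v) - f (x, v))
        + κ * (f (x + 1, v) + f (x - 1, v) - 2 * f (x, v))
        + γ * (f (x, -v) - f (x, v)) :=
  rfl

/-- The semigroup `exp (t L)` generated by a bounded operator `L` on a normed space. -/
def expSemigroup {E : Type*} [NormedAddCommGroup E] [NormedSpace ℝ E] (L : E →L[ℝ] E) (t : ℝ) :
    E →L[ℝ] E :=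
  NormedSpace.exp (t • L)

/-- The Markov semigroup `exp (t L)` of the run-and-tumble particle. -/
def semigroup (lam κ γ : ℝ) (t : ℝ≥0) : (State →ᵇ ℝ) →L[ℝ] (State →ᵇ ℝ) :=
  expSemigroup (generator lam κ γ) (t : ℝ)

/-- `(X_t, V_t)` is the run-and-tumble particle with rates `lam`, `κ`, `γ`: a Markov process (with
respect to the filtration `ℱ`) whose semigroup is the one of the generator, started from position
`0` with a uniformly distributed velocity. -/
structure IsRunAndTumble {Ω : Type*} [mΩ : MeasurableSpace Ω] (lam κ γ : ℝ)
    (ℱ : Filtration ℝ≥0 mΩ) (X : ℝ≥0 → Ω → ℤ) (V : ℝ≥0 → Ω → ℤˣ) (μ : Measure Ω) : Prop where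
  measurable_position : ∀ t, Measurable[ℱ t] (X t)
  measurable_velocity : ∀ t, Measurable[ℱ t] (V t)
  markov : ∀ (s t : ℝ≥0) (f : State →ᵇ ℝ),
    μ[fun ω => f (X (s + t) ω, V (s + t) ω) | ℱ s]
      =ᵐ[μ] fun ω => semigroup lam κ γ t f (X s ω, V s ω)
  position_zero : ∀ᵐ ω ∂μ, X 0 ω = 0
  velocity_zero : ∀ v : ℤˣ, μ {ω | V 0 ω = v} = 1 / 2

/-- The large deviation principle (speed `t`, as `t → ∞`) for real random variables `Z_t` with rate
function `I`; `ENNReal.log 0 = -∞` and the infimum over the empty set is `+∞`. -/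
structure SatisfiesLDP {Ω : Type*} [MeasurableSpace Ω] (μ : Measure Ω) (Z : ℝ≥0 → Ω → ℝ)
    (I : ℝ → EReal) : Prop where
  nonneg : ∀ x, 0 ≤ I x
  lowerSemicontinuous : LowerSemicontinuous I
  upper_bound : ∀ B : Set ℝ, IsClosed B →
    limsup (fun t : ℝ≥0 => ((1 / (t : ℝ) : ℝ) : EReal) * ENNReal.log (μ {ω | Z t ω ∈ B})) atTop
      ≤ -(⨅ x ∈ B, I x)
  lower_bound : ∀ G : Set ℝ, IsOpen G →
    -(⨅ x ∈ G, I x)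
      ≤ liminf (fun t : ℝ≥0 => ((1 / (t : ℝ) : ℝ) : EReal) * ENNReal.log (μ {ω | Z t ω ∈ G})) atTop

/-- The Legendre transform `x ↦ sup_α (α x - F α)`, with values in `[-∞, ∞]`. -/
def legendre (F : ℝ → ℝ) (x : ℝ) : EReal :=
  ⨆ α : ℝ, ((α * x - F α : ℝ) : EReal)

/-- The explicit free energy function. -/
def freeEnergy (lam κ γ α : ℝ) : ℝ :=
  (2 * κ + lam) * (Real.cosh α - 1) + √(γ ^ 2 + lam ^ 2 * Real.sinh α ^ 2) - γ

/-- The matrix `M(q)` of the Fourier transformed master equation, rows and columns indexed by the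
velocities `1, -1`. For real `q` the two diagonal entries are complex conjugates; this is the
analytic continuation to complex `q`. -/
def fourierMatrix (lam κ γ : ℝ) (q : ℂ) : Matrix (Fin 2) (Fin 2) ℂ :=
  !![(2 * κ + lam) * (Complex.cos q - 1) - γ + Complex.I * lam * Complex.sin q, (γ : ℂ);
     (γ : ℂ), (2 * κ + lam) * (Complex.cos q - 1) - γ - Complex.I * lam * Complex.sin q]

end RunTumble

end

/-!
For `b = lam sinh α` and `s = √(γ² + b²)`, the function `e^{α x} (s + v b + γ)` of the state
`(x, v)` is an eigenfunction of the generator with eigenvalue `F α`. It is comparable to `e^{α x}`,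
so `E[e^{α X_t}]` equals `e^{t F α}` up to constants, which is (b). Truncating the unbounded
eigenfunction justifies applying the semigroup to it, because the semigroup is a Poisson mixture of
iterates of a monotone operator.

The large deviation principle is the Gärtner–Ellis theorem for the everywhere differentiable `F`.
The upper bound is the Chernoff bound on both sides of the mean `deriv F 0`. For the lower bound,
tilting by `η` makes a neighbourhood of `deriv F η` typical; a point `x` with `I x < ∞` need not be
of the form `deriv F η`, but it is a limit of such points with rate at most `I x`.
-/

namespace RunTumble

/-! ### The Gärtner–Ellis theorem -/

section GartnerEllis

variable {Ω : Type*} [MeasurableSpace Ω] {μ : Measure Ω}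

theorem convexOn_cgf {Y : Ω → ℝ} :
    ConvexOn ℝ (interior (integrableExpSet Y μ)) (cgf Y μ) := by
  have hcgf := analyticOnNhd_cgf (X := Y) (μ := μ)
  refine convexOn_of_deriv2_nonneg' convex_integrableExpSet.interior hcgf.differentiableOn
    hcgf.deriv.differentiableOn fun α hα => ?_
  rw [← iteratedDeriv_eq_iterate, ← variance_tilted_mul hα]
  exact variance_nonneg _ _

theorem mgf_le_measureReal_abs_sub_lt_add [IsFiniteMeasure μ] {Y : Ω → ℝ}
    (hint : ∀ α, Integrable (fun ω => Real.exp (α * Y ω)) μ) {a : ℝ} (ha : 0 ≤ a) (η y δ : ℝ) :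
    mgf Y μ η ≤ Real.exp (η * y + |η| * δ) * μ.real {ω | |Y ω - y| < δ}
      + Real.exp (-(a * (y + δ))) * mgf Y μ (η + a)
      + Real.exp (a * (y - δ)) * mgf Y μ (η - a) := by
  set A : Set Ω := {ω | |Y ω - y| < δ}
  have hY : AEMeasurable Y μ := aemeasurable_of_integrable_exp_mul zero_ne_one (hint 0) (hint 1)
  have hA : NullMeasurableSet A μ :=
    nullMeasurableSet_lt (hY.sub_const y).abs aemeasurable_const
  -- Off `A`, the term with `η + a` (to the right of `y`) or `η - a` (to the left) dominates.
  have hpointwise (ω : Ω) : Real.exp (η * Y ω) ≤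
      A.indicator (fun _ => Real.exp (η * y + |η| * δ)) ω
        + Real.exp (-(a * (y + δ))) * Real.exp ((η + a) * Y ω)
        + Real.exp (a * (y - δ)) * Real.exp ((η - a) * Y ω) := by
    rw [← Real.exp_add, ← Real.exp_add]
    by_cases hω : ω ∈ A
    · rw [Set.indicator_of_mem hω, add_assoc]
      have hdev : η * (Y ω - y) ≤ |η| * δ := by
        refine (le_abs_self _).trans ?_
        rw [abs_mul]
        gcongr
        exact hω.le
      exact le_add_of_le_of_nonneg (Real.exp_le_exp.2 (by linarith)) (by positivity)
    · rw [Set.indicator_of_notMem hω, zero_add]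
      rcases le_abs.1 (not_lt.1 (Set.notMem_ofPred_iff.1 hω)) with hright | hleft
      · exact le_add_of_le_of_nonneg (Real.exp_le_exp.2 (by nlinarith)) (by positivity)
      · exact le_add_of_nonneg_of_le (by positivity) (Real.exp_le_exp.2 (by nlinarith))
  have hcenter : Integrable (A.indicator fun _ => Real.exp (η * y + |η| * δ)) μ :=
    (integrable_const _).indicator₀ hA
  have hright := (hint (η + a)).const_mul (Real.exp (-(a * (y + δ))))
  have hleft := (hint (η - a)).const_mul (Real.exp (a * (y - δ)))
  refine (integral_mono (hint η) ((hcenter.add hright).add hleft) hpointwise).trans_eq ?_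
  rw [integral_add' (hcenter.add hright) hleft, integral_add' hcenter hright,
    integral_indicator₀ hA, setIntegral_const, integral_const_mul, integral_const_mul, smul_eq_mul,
    mul_comm (μ.real A)]
  rfl

theorem eventually_const_mul_exp_le {r s : ℝ} (hrs : r < s) (K : ℝ) :
    ∀ᶠ t : ℝ≥0 in atTop, K * Real.exp (r * t) ≤ Real.exp (s * t) := by
  have hgrowth : Tendsto (fun t : ℝ≥0 => Real.exp ((s - r) * t)) atTop atTop :=
    Real.tendsto_exp_atTop.comp
      ((NNReal.tendsto_coe_atTop.2 tendsto_id).const_mul_atTop (sub_pos.2 hrs))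
  filter_upwards [hgrowth.eventually_ge_atTop K] with t ht
  calc K * Real.exp (r * t) ≤ Real.exp ((s - r) * t) * Real.exp (r * t) := by gcongr
    _ = Real.exp (s * t) := by rw [← Real.exp_add]; ring_nf

theorem one_div_mul_log_ofReal_exp {t : ℝ≥0} (ht : 0 < t) (r : ℝ) :
    ((1 / (t : ℝ) : ℝ) : EReal) * ENNReal.log (ENNReal.ofReal (Real.exp (r * t))) = r := by
  have : (0 : ℝ) < t := ht
  rw [ENNReal.log_ofReal_of_pos (Real.exp_pos _), Real.log_exp, ← EReal.coe_mul]
  congr 1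
  field_simp

theorem limsup_log_measure_le [IsFiniteMeasure μ] {A : ℝ≥0 → Set Ω} {r : ℝ}
    (h : ∀ᶠ t : ℝ≥0 in atTop, μ.real (A t) ≤ Real.exp (r * t)) :
    limsup (fun t : ℝ≥0 => ((1 / (t : ℝ) : ℝ) : EReal) * ENNReal.log (μ (A t))) atTop ≤ r := by
  refine limsup_le_of_le (h := ?_)
  filter_upwards [h, eventually_gt_atTop 0] with t hle ht
  rw [← one_div_mul_log_ofReal_exp ht r, ← ofReal_measureReal]
  gcongr

theorem le_liminf_log_measure [IsFiniteMeasure μ] {A : ℝ≥0 → Set Ω} {r : ℝ}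
    (h : ∀ᶠ t : ℝ≥0 in atTop, Real.exp (r * t) ≤ μ.real (A t)) :
    r ≤ liminf (fun t : ℝ≥0 => ((1 / (t : ℝ) : ℝ) : EReal) * ENNReal.log (μ (A t))) atTop := by
  refine le_liminf_of_le (h := ?_)
  filter_upwards [h, eventually_gt_atTop 0] with t hle ht
  rw [← one_div_mul_log_ofReal_exp ht r, ← ofReal_measureReal]
  gcongr

/-- `F` is the large deviation free energy of the real-valued process `Y` under `μ`: all exponential
moments of `Y t` are finite, and those of order `α` grow at the exponential rate `F α`. -/
structure HasFreeEnergy (μ : Measure Ω) (Y : ℝ≥0 → Ω → ℝ) (F : ℝ → ℝ) : Prop where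
  integrable_exp_mul : ∀ α t, Integrable (fun ω => Real.exp (α * Y t ω)) μ
  tendsto_cgf : ∀ α, Tendsto (fun t : ℝ≥0 => 1 / (t : ℝ) * cgf (Y t) μ α) atTop (𝓝 (F α))

theorem lowerSemicontinuous_legendre (F : ℝ → ℝ) : LowerSemicontinuous (legendre F) :=
  lowerSemicontinuous_iSup fun α =>
    (continuous_coe_real_ereal.comp (by fun_prop)).lowerSemicontinuous

theorem legendre_nonneg {F : ℝ → ℝ} (h0 : F 0 = 0) (x : ℝ) : 0 ≤ legendre F x :=
  le_iSup_of_le 0 (by simp [h0])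

theorem legendre_comp_neg (F : ℝ → ℝ) (x : ℝ) :
    legendre (fun α => F (-α)) x = legendre F (-x) :=
  (Equiv.neg ℝ).iSup_congr fun α => by simp

theorem exists_nonneg_lt_of_lt_legendre {F : ℝ → ℝ} {m b r : ℝ} (hF : ConvexOn ℝ Set.univ F)
    (h0 : F 0 = 0) (hm : HasDerivAt F m 0) (hmb : m ≤ b) (hr : r < legendre F b) :
    ∃ α, 0 ≤ α ∧ r < α * b - F α := by
  obtain ⟨α, hα⟩ := lt_iSup_iff.1 hr
  rw [EReal.coe_lt_coe_iff] at hα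
  rcases le_or_gt 0 α with hα0 | hα0
  · exact ⟨α, hα0, hα⟩
  refine ⟨0, le_rfl, ?_⟩
  have htangent : α * m ≤ F α := by
    have hslope := hF.slope_le_of_hasDerivAt (Set.mem_univ α) (Set.mem_univ 0) hα0 hm
    rw [slope_def_field, h0, div_le_iff₀ (by linarith)] at hslope
    linarith
  have : α * b ≤ α * m := mul_le_mul_of_nonpos_left hmb hα0.le
  linarith

/-- Maximizing `α ↦ α x - F α - κ α² / 2` instead of `α ↦ α x - F α` makes the maximum attained; at
the maximizer `η` the derivative of `F` is `x - κ η`, and `κ η → 0` as `κ → 0`. -/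
theorem exists_hasDerivAt_mul_sub_le {F : ℝ → ℝ} (hF : Differentiable ℝ F) {x C ε : ℝ}
    (hC : ∀ α, α * x - F α ≤ C) (hε : 0 < ε) :
    ∃ η y, HasDerivAt F y η ∧ |y - x| < ε ∧ η * y - F η ≤ C := by
  have hC0 : 0 ≤ C + F 0 := by linarith [hC 0]
  set κ := ε ^ 2 / (2 * (C + F 0) + 1)
  have hκ : 0 < κ := by positivity
  obtain ⟨η, hη⟩ : ∃ η, ∀ α, α * x - F α - κ / 2 * α ^ 2 ≤ η * x - F η - κ / 2 * η ^ 2 := by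
    have := hF.continuous
    refine Continuous.exists_forall_ge (by fun_prop) ?_
    have hsq : Tendsto (fun α : ℝ => C - κ / 2 * α ^ 2) (cocompact ℝ) atBot := by
      have habs := (tendsto_pow_atTop two_ne_zero).comp (tendsto_norm_cocompact_atTop (E := ℝ))
      simp only [Function.comp_def, Real.norm_eq_abs, sq_abs] at habs
      simpa only [sub_eq_add_neg, Function.comp_def] using tendsto_atBot_add_const_left _ C
        (tendsto_neg_atTop_atBot.comp (habs.const_mul_atTop (half_pos hκ)))
    exact tendsto_atBot_mono (fun α => by linarith [hC α]) hsq
  have hderiv : HasDerivAt (fun α => α * x - F α - κ / 2 * α ^ 2) (x - deriv F η - κ * η) η := by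
    convert! (((hasDerivAt_id η).mul_const x).sub (hF η).hasDerivAt).sub
      ((hasDerivAt_pow 2 η).const_mul (κ / 2)) using 1
    simp only [one_mul, Nat.cast_ofNat, Nat.add_one_sub_one, pow_one]
    ring
  have hcritical : x - deriv F η - κ * η = 0 :=
    IsLocalMax.hasDerivAt_eq_zero (Eventually.of_forall hη) hderiv
  have hκη : κ * η ^ 2 ≤ 2 * (C + F 0) := by linarith [hη 0, hC η]
  refine ⟨η, deriv F η, (hF η).hasDerivAt, ?_, ?_⟩
  · refine abs_lt_of_sq_lt_sq ?_ hε.le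
    calc (deriv F η - x) ^ 2 = κ * (κ * η ^ 2) := by
          rw [show deriv F η - x = -(κ * η) by linarith]; ring
      _ ≤ κ * (2 * (C + F 0)) := by gcongr
      _ < κ * (2 * (C + F 0) + 1) := by gcongr; linarith
      _ = ε ^ 2 := div_mul_cancel₀ _ (by positivity)
  · rw [show deriv F η = x - κ * η by linarith]
    nlinarith [hC η]

theorem exists_pos_forall_abs_eq_lt_add_mul {F : ℝ → ℝ} {y η δ : ℝ} (hF : HasDerivAt F y η)
    (hδ : 0 < δ) : ∃ a, 0 < a ∧ ∀ u, |u| = a → F (η + u) < F η + u * y + a * δ := by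
  have hsmall := (hasDerivAt_iff_isLittleO_nhds_zero.1 hF).def (half_pos hδ)
  obtain ⟨ε, hε, happrox⟩ := Metric.eventually_nhds_iff.1 hsmall
  refine ⟨ε / 2, half_pos hε, fun u hu => ?_⟩
  have hu' := (le_abs_self _).trans (happrox (y := u) (by simpa [hu] using hε))
  rw [Real.norm_eq_abs, hu, smul_eq_mul] at hu'
  linarith [mul_pos hε hδ]

theorem tendsto_one_div_mul_cgf_of_mgf_bounds {Y : ℝ≥0 → Ω → ℝ} {α Λ c C : ℝ} (hc : 0 < c)
    (hlower : ∀ t : ℝ≥0, c * Real.exp (Λ * t) ≤ mgf (Y t) μ α)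
    (hupper : ∀ t : ℝ≥0, mgf (Y t) μ α ≤ C * Real.exp (Λ * t)) :
    Tendsto (fun t : ℝ≥0 => 1 / (t : ℝ) * cgf (Y t) μ α) atTop (𝓝 Λ) := by
  have hC : 0 < C :=
    pos_of_mul_pos_left ((mul_pos hc (Real.exp_pos _)).trans_le ((hlower 0).trans (hupper 0)))
      (Real.exp_nonneg _)
  have hlog {K : ℝ} (hK : 0 < K) :
      Tendsto (fun t : ℝ≥0 => 1 / (t : ℝ) * Real.log (K * Real.exp (Λ * t))) atTop (𝓝 Λ) := by
    have hinv : Tendsto (fun t : ℝ≥0 => Real.log K / (t : ℝ) + Λ) atTop (𝓝 (0 + Λ)) :=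
      ((NNReal.tendsto_coe_atTop.2 tendsto_id).const_div_atTop _).add_const Λ
    rw [zero_add] at hinv
    refine hinv.congr' ?_
    filter_upwards [eventually_gt_atTop 0] with t ht
    have : (t : ℝ) ≠ 0 := by exact_mod_cast ht.ne'
    rw [Real.log_mul hK.ne' (Real.exp_ne_zero _), Real.log_exp]
    field_simp
  refine tendsto_of_tendsto_of_tendsto_of_le_of_le (hlog hc) (hlog hC) (fun t => ?_) fun t => ?_
  · unfold cgf
    gcongr
    exact hlower t
  · have := (mul_pos hc (Real.exp_pos _)).trans_le (hlower t)
    unfold cgf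
    gcongr
    exact hupper t

namespace HasFreeEnergy

variable {Y : ℝ≥0 → Ω → ℝ} {F : ℝ → ℝ}

theorem neg (h : HasFreeEnergy μ Y F) :
    HasFreeEnergy μ (fun t ω => -Y t ω) (fun α => F (-α)) where
  integrable_exp_mul α t := by simpa using h.integrable_exp_mul (-α) t
  tendsto_cgf α := by
    have (t : ℝ≥0) : cgf (fun ω => -Y t ω) μ α = cgf (Y t) μ (-α) := cgf_neg
    simpa only [this] using h.tendsto_cgf (-α)

theorem convexOn (h : HasFreeEnergy μ Y F) : ConvexOn ℝ Set.univ F := by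
  have hconvex (t : ℝ≥0) : ConvexOn ℝ Set.univ fun α => 1 / (t : ℝ) * cgf (Y t) μ α := by
    have hset : integrableExpSet (Y t) μ = Set.univ :=
      Set.eq_univ_of_forall fun α => h.integrable_exp_mul α t
    have hcgf := convexOn_cgf (μ := μ) (Y := Y t)
    rw [hset, interior_univ] at hcgf
    exact hcgf.smul (by positivity)
  refine ⟨convex_univ, fun α _ β _ a b ha hb hab => ?_⟩
  exact le_of_tendsto_of_tendsto' (h.tendsto_cgf _)
    (((h.tendsto_cgf α).const_smul a).add ((h.tendsto_cgf β).const_smul b))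
    fun t => (hconvex t).2 (Set.mem_univ α) (Set.mem_univ β) ha hb hab

variable [IsProbabilityMeasure μ]

theorem apply_zero (h : HasFreeEnergy μ Y F) : F 0 = 0 :=
  tendsto_nhds_unique (h.tendsto_cgf 0) (by simp)

theorem eventually_mgf_le (h : HasFreeEnergy μ Y F) {α r : ℝ} (hr : F α < r) :
    ∀ᶠ t : ℝ≥0 in atTop, mgf (Y t) μ α ≤ Real.exp (r * t) := by
  filter_upwards [(h.tendsto_cgf α).eventually_le_const hr, eventually_gt_atTop 0] with t ht hpos
  have : (0 : ℝ) < t := hpos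
  rw [one_div_mul_eq_div, div_le_iff₀ this] at ht
  exact (Real.log_le_iff_le_exp (mgf_pos (h.integrable_exp_mul α t))).1 ht

theorem eventually_le_mgf (h : HasFreeEnergy μ Y F) {α r : ℝ} (hr : r < F α) :
    ∀ᶠ t : ℝ≥0 in atTop, Real.exp (r * t) ≤ mgf (Y t) μ α := by
  filter_upwards [(h.tendsto_cgf α).eventually_const_le hr, eventually_gt_atTop 0] with t ht hpos
  have : (0 : ℝ) < t := hpos
  rw [one_div_mul_eq_div, le_div_iff₀ this] at ht
  exact (Real.le_log_iff_exp_le (mgf_pos (h.integrable_exp_mul α t))).1 ht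

theorem eventually_measureReal_le_div_le (h : HasFreeEnergy μ Y F) {m b r : ℝ}
    (hm : HasDerivAt F m 0) (hmb : m ≤ b) (hr : r < legendre F b) :
    ∀ᶠ t : ℝ≥0 in atTop, μ.real {ω | b ≤ Y t ω / t} ≤ Real.exp (-r * t) := by
  obtain ⟨α, hα, hαr⟩ := exists_nonneg_lt_of_lt_legendre h.convexOn h.apply_zero hm hmb hr
  filter_upwards [h.eventually_mgf_le (show F α < α * b - r by linarith), eventually_gt_atTop 0]
    with t hmgf hpos
  have : (0 : ℝ) < t := hpos
  calc μ.real {ω | b ≤ Y t ω / t} = μ.real {ω | b * t ≤ Y t ω} := by simp_rw [le_div_iff₀ this]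
    _ ≤ Real.exp (-α * (b * t)) * mgf (Y t) μ α :=
      measure_ge_le_exp_mul_mgf _ hα (h.integrable_exp_mul α t)
    _ ≤ Real.exp (-α * (b * t)) * Real.exp ((α * b - r) * t) := by gcongr
    _ = Real.exp (-r * t) := by rw [← Real.exp_add]; ring_nf

theorem eventually_measureReal_le_of_subset_Ici (h : HasFreeEnergy μ Y F) {m r : ℝ} {B : Set ℝ}
    (hm : HasDerivAt F m 0) (hB : IsClosed B) (hmB : B ⊆ Set.Ici m)
    (hr : ∀ x ∈ B, r < legendre F x) :
    ∀ᶠ t : ℝ≥0 in atTop, μ.real {ω | Y t ω / t ∈ B} ≤ Real.exp (-r * t) := by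
  rcases B.eq_empty_or_nonempty with rfl | hne
  · simp [Real.exp_nonneg]
  have hbdd : BddBelow B := ⟨m, hmB⟩
  have hmin : sInf B ∈ B := hB.csInf_mem hne hbdd
  filter_upwards [h.eventually_measureReal_le_div_le hm (hmB hmin) (hr _ hmin)] with t ht
  have hsubset : {ω | Y t ω / t ∈ B} ⊆ {ω | sInf B ≤ Y t ω / t} := fun ω hω => csInf_le hbdd hω
  exact (measureReal_mono hsubset).trans ht

theorem eventually_measureReal_le_of_subset_Iic (h : HasFreeEnergy μ Y F) {m r : ℝ} {B : Set ℝ}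
    (hm : HasDerivAt F m 0) (hB : IsClosed B) (hmB : B ⊆ Set.Iic m)
    (hr : ∀ x ∈ B, r < legendre F x) :
    ∀ᶠ t : ℝ≥0 in atTop, μ.real {ω | Y t ω / t ∈ B} ≤ Real.exp (-r * t) := by
  have hm' : HasDerivAt (fun α => F (-α)) (-m) 0 := by
    simpa [Function.comp_def] using hm.scomp_of_eq 0 (hasDerivAt_neg 0) neg_zero.symm
  simpa [neg_div] using h.neg.eventually_measureReal_le_of_subset_Ici hm'
    (hB.preimage continuous_neg) (fun x hx => neg_le.1 (Set.mem_Iic.1 (hmB hx)))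
    fun x hx => (hr _ hx).trans_eq (legendre_comp_neg F x).symm

theorem ldp_upper_bound (h : HasFreeEnergy μ Y F) (hF : DifferentiableAt ℝ F 0) {B : Set ℝ}
    (hB : IsClosed B) :
    limsup (fun t : ℝ≥0 =>
        ((1 / (t : ℝ) : ℝ) : EReal) * ENNReal.log (μ {ω | Y t ω / t ∈ B})) atTop
      ≤ -(⨅ x ∈ B, legendre F x) := by
  rw [EReal.le_neg]
  refine EReal.ge_of_forall_gt_iff_ge.1 fun r hr => ?_
  obtain ⟨s, hrs, hs⟩ := EReal.lt_iff_exists_real_btwn.1 hr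
  rw [EReal.coe_lt_coe_iff] at hrs
  have hsB : ∀ x ∈ B, s < legendre F x := fun x hx => hs.trans_le (iInf₂_le x hx)
  set m := deriv F 0
  rw [EReal.le_neg, ← EReal.coe_neg]
  refine limsup_log_measure_le ?_
  filter_upwards [h.eventually_measureReal_le_of_subset_Ici hF.hasDerivAt
      (hB.inter isClosed_Ici) Set.inter_subset_right fun x hx => hsB x hx.1,
    h.eventually_measureReal_le_of_subset_Iic hF.hasDerivAt
      (hB.inter isClosed_Iic) Set.inter_subset_right fun x hx => hsB x hx.1,
    eventually_const_mul_exp_le (neg_lt_neg hrs) 2] with t hright hleft hslack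
  have hunion : {ω | Y t ω / t ∈ B} =
      {ω | Y t ω / t ∈ B ∩ Set.Ici m} ∪ {ω | Y t ω / t ∈ B ∩ Set.Iic m} := by
    change (fun ω => Y t ω / t) ⁻¹' B = (fun ω => Y t ω / t) ⁻¹' ((B ∩ Set.Ici m) ∪ (B ∩ Set.Iic m))
    rw [← Set.inter_union_distrib_left, Set.Ici_union_Iic, Set.inter_univ]
  rw [hunion]
  linarith [measureReal_union_le (μ := μ) {ω | Y t ω / t ∈ B ∩ Set.Ici m}
    {ω | Y t ω / t ∈ B ∩ Set.Iic m}]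

theorem eventually_exp_le_measureReal_abs_div_sub_lt (h : HasFreeEnergy μ Y F) {y η δ r : ℝ}
    (hy : HasDerivAt F y η) (hδ : 0 < δ) (hr : r < F η - η * y - |η| * δ) :
    ∀ᶠ t : ℝ≥0 in atTop, Real.exp (r * t) ≤ μ.real {ω | |Y t ω / t - y| < δ} := by
  obtain ⟨a, ha, hslope⟩ := exists_pos_forall_abs_eq_lt_add_mul hy hδ
  have hright : F (η + a) - a * (y + δ) < F η := by linarith [hslope a (abs_of_pos ha)]
  have hleft : F (η - a) + a * (y - δ) < F η := by
    have := hslope (-a) (by rw [abs_neg, abs_of_pos ha])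
    rw [← sub_eq_add_neg] at this
    linarith
  have hcenter : r + η * y + |η| * δ < F η := by linarith
  obtain ⟨s, hs, hsη⟩ := exists_between (max_lt hright (max_lt hleft hcenter))
  obtain ⟨s', hss', hs'⟩ := exists_between hsη
  simp only [max_lt_iff, sub_lt_iff_lt_add, ← lt_sub_iff_add_lt] at hs
  obtain ⟨hsright, hsleft, hscenter⟩ := hs
  filter_upwards [h.eventually_le_mgf hs', h.eventually_mgf_le hsright, h.eventually_mgf_le hsleft,
    eventually_const_mul_exp_le hss' 3, eventually_gt_atTop 0] with t hmgf hmgfr hmgfl hslack hpos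
  have ht : (0 : ℝ) < t := hpos
  have hball : {ω | |Y t ω - y * t| < δ * t} = {ω | |Y t ω / t - y| < δ} := by
    ext ω
    have : Y t ω / t - y = (Y t ω - y * t) / t := by field_simp
    rw [Set.mem_ofPred_eq, Set.mem_ofPred_eq, this, abs_div, abs_of_pos ht, div_lt_iff₀ ht]
  have htilt := mgf_le_measureReal_abs_sub_lt_add (fun α => h.integrable_exp_mul α t) ha.le η
    (y * t) (δ * t)
  rw [hball] at htilt
  have hrightTail : Real.exp (-(a * (y * t + δ * t))) * mgf (Y t) μ (η + a) ≤ Real.exp (s * t) := by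
    calc _ ≤ Real.exp (-(a * (y * t + δ * t))) * Real.exp ((s + a * (y + δ)) * t) := by gcongr
      _ = Real.exp (s * t) := by rw [← Real.exp_add]; ring_nf
  have hleftTail : Real.exp (a * (y * t - δ * t)) * mgf (Y t) μ (η - a) ≤ Real.exp (s * t) := by
    calc _ ≤ Real.exp (a * (y * t - δ * t)) * Real.exp ((s - a * (y - δ)) * t) := by gcongr
      _ = Real.exp (s * t) := by rw [← Real.exp_add]; ring_nf
  have hmain : Real.exp (s * t) ≤
      Real.exp (η * (y * t) + |η| * (δ * t)) * μ.real {ω | |Y t ω / t - y| < δ} := by linarith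
  rw [← div_le_iff₀' (Real.exp_pos _), ← Real.exp_sub] at hmain
  refine le_trans (Real.exp_le_exp.2 ?_) hmain
  nlinarith

theorem eventually_exp_le_measureReal_of_isOpen (h : HasFreeEnergy μ Y F) (hF : Differentiable ℝ F)
    {G : Set ℝ} (hG : IsOpen G) {x C r : ℝ} (hx : x ∈ G) (hC : ∀ α, α * x - F α ≤ C)
    (hr : r < -C) :
    ∀ᶠ t : ℝ≥0 in atTop, Real.exp (r * t) ≤ μ.real {ω | Y t ω / t ∈ G} := by
  obtain ⟨ε, hε, hball⟩ := Metric.isOpen_iff.1 hG x hx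
  obtain ⟨η, y, hy, hyx, hηy⟩ := exists_hasDerivAt_mul_sub_le hF hC hε
  have hcost : ∀ᶠ δ in 𝓝 (0 : ℝ), r < F η - η * y - |η| * δ :=
    continuousAt_const.eventually_lt (by fun_prop) (by linarith)
  obtain ⟨δ, hδr, hδ, hδε⟩ := ((hcost.filter_mono nhdsWithin_le_nhds).and
    (Ioo_mem_nhdsGT (sub_pos.2 hyx))).exists
  filter_upwards [h.eventually_exp_le_measureReal_abs_div_sub_lt hy hδ hδr] with t ht
  refine ht.trans (measureReal_mono fun ω hω => hball ?_)
  rw [Metric.mem_ball, Real.dist_eq]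
  linarith [abs_sub_le (Y t ω / t) y x, Set.mem_ofPred_eq ▸ hω]

theorem ldp_lower_bound (h : HasFreeEnergy μ Y F) (hF : Differentiable ℝ F) {G : Set ℝ}
    (hG : IsOpen G) :
    -(⨅ x ∈ G, legendre F x) ≤ liminf (fun t : ℝ≥0 =>
      ((1 / (t : ℝ) : ℝ) : EReal) * ENNReal.log (μ {ω | Y t ω / t ∈ G})) atTop := by
  rw [EReal.neg_le]
  refine le_iInf₂ fun x hx => EReal.le_of_forall_lt_iff_le.1 fun r hr => ?_
  obtain ⟨C, hC, hCr⟩ := EReal.lt_iff_exists_real_btwn.1 hr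
  rw [EReal.coe_lt_coe_iff] at hCr
  rw [EReal.neg_le, ← EReal.coe_neg]
  refine le_liminf_log_measure (h.eventually_exp_le_measureReal_of_isOpen hF hG hx (C := C)
    (fun α => ?_) (neg_lt_neg hCr))
  exact EReal.coe_le_coe_iff.1 ((le_iSup _ α).trans hC.le)

theorem satisfiesLDP (h : HasFreeEnergy μ Y F) (hF : Differentiable ℝ F) :
    SatisfiesLDP μ (fun t ω => Y t ω / t) (legendre F) where
  nonneg := legendre_nonneg h.apply_zero
  lowerSemicontinuous := lowerSemicontinuous_legendre F
  upper_bound _ := h.ldp_upper_bound hF.differentiableAt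
  lower_bound _ := h.ldp_lower_bound hF

end HasFreeEnergy

end GartnerEllis

/-! ### The semigroup on eigenfunctions -/

section Semigroup

variable {lam κ γ : ℝ}

theorem expSemigroup_add_smul_one {E : Type*} [NormedAddCommGroup E] [NormedSpace ℝ E]
    [CompleteSpace E] (A : E →L[ℝ] E) (c t : ℝ) :
    expSemigroup (A + c • 1) t = Real.exp (c * t) • expSemigroup A t := by
  let +nondep : NormedAlgebra ℚ (E →L[ℝ] E) := .restrictScalars ℚ ℝ _
  have hsplit : t • (A + c • 1) = t • A + algebraMap ℝ (E →L[ℝ] E) (c * t) := by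
    rw [smul_add, Algebra.algebraMap_eq_smul_one, smul_smul, mul_comm]
  rw [expSemigroup, expSemigroup, hsplit,
    NormedSpace.exp_add_of_commute (Algebra.commutes _ _).symm, ← NormedSpace.algebraMap_exp_comm,
    ← Real.exp_eq_exp_ℝ, Algebra.algebraMap_eq_smul_one, mul_smul_comm, mul_one]

theorem hasSum_expSemigroup_apply {E : Type*} [NormedAddCommGroup E] [NormedSpace ℝ E]
    [CompleteSpace E] (A : E →L[ℝ] E) (t : ℝ) (f : E) :
    HasSum (fun n : ℕ => ((n.factorial : ℝ)⁻¹ * t ^ n) • (A ^ n) f) (expSemigroup A t f) := by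
  have hseries := (NormedSpace.exp_series_hasSum_exp' (𝕂 := ℝ) (t • A)).mapL
    (ContinuousLinearMap.apply ℝ E f)
  simpa only [smul_pow, smul_smul, ContinuousLinearMap.apply_apply, smul_apply,
    expSemigroup] using hseries

/-- The gain part of the generator, acting on arbitrary functions on the state space: the generator
is the gain minus the total jump rate `lam + 2 κ + γ`. -/
def gain (lam κ γ : ℝ) (φ : State → ℝ) (p : State) : ℝ :=
  lam * φ (p.1 + (p.2 : ℤ), p.2) + κ * (φ (p.1 + 1, p.2) + φ (p.1 - 1, p.2)) + γ * φ (p.1, -p.2)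

theorem gain_smul (c : ℝ) (φ : State → ℝ) : gain lam κ γ (c • φ) = c • gain lam κ γ φ := by
  ext p
  simp only [gain, Pi.smul_apply, smul_eq_mul]
  ring

theorem gain_mono (hlam : 0 ≤ lam) (hκ : 0 ≤ κ) (hγ : 0 ≤ γ) : Monotone (gain lam κ γ) := by
  intro φ ψ hle p
  unfold gain
  gcongr <;> apply hle

theorem continuous_gain : Continuous (gain lam κ γ) := by
  unfold gain
  fun_prop

/-- The gain part of the generator as a bounded operator on bounded functions. -/
noncomputable def gainOperator (lam κ γ : ℝ) : (State →ᵇ ℝ) →L[ℝ] (State →ᵇ ℝ) :=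
  lam • pullback (fun p => (p.1 + (p.2 : ℤ), p.2))
    + κ • (pullback (fun p => (p.1 + 1, p.2)) + pullback (fun p => (p.1 - 1, p.2)))
    + γ • pullback (fun p => (p.1, -p.2))

theorem coe_gainOperator_apply (f : State →ᵇ ℝ) : ⇑(gainOperator lam κ γ f) = gain lam κ γ f :=
  rfl

theorem coe_gainOperator_pow_apply (n : ℕ) (f : State →ᵇ ℝ) :
    ⇑((gainOperator lam κ γ ^ n) f) = (gain lam κ γ)^[n] f := by
  induction n with
  | zero => rfl
  | succ n ih =>
    rw [pow_succ', mul_apply_eq_comp, coe_gainOperator_apply, ih, Function.iterate_succ_apply']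

theorem generator_eq_gainOperator_add :
    generator lam κ γ = gainOperator lam κ γ + (-(lam + 2 * κ + γ)) • 1 := by
  unfold generator gainOperator
  module

theorem hasSum_semigroup_apply (t : ℝ≥0) (f : State →ᵇ ℝ) (p : State) :
    HasSum (fun n : ℕ => Real.exp (-(lam + 2 * κ + γ) * t) *
        ((n.factorial : ℝ)⁻¹ * (t : ℝ) ^ n * (gain lam κ γ)^[n] f p))
      (semigroup lam κ γ t f p) := by
  simp_rw [semigroup, generator_eq_gainOperator_add, expSemigroup_add_smul_one,
    ← coe_gainOperator_pow_apply]
  exact ((hasSum_expSemigroup_apply (gainOperator lam κ γ) t f).mapL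
    (BoundedContinuousFunction.evalCLM ℝ p)).mul_left _

theorem iterate_gain_of_eigenfunction {φ : State → ℝ} {Λ : ℝ} (heig : gain lam κ γ φ = Λ • φ)
    (n : ℕ) : (gain lam κ γ)^[n] φ = Λ ^ n • φ := by
  induction n with
  | zero => simp
  | succ n ih => rw [Function.iterate_succ_apply', ih, gain_smul, heig, smul_smul, pow_succ]

theorem hasSum_exp_mul_inv_factorial_mul_pow (Λ c t a : ℝ) :
    HasSum (fun n : ℕ => Real.exp (-c * t) * ((n.factorial : ℝ)⁻¹ * t ^ n * (Λ ^ n * a)))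
      (Real.exp ((Λ - c) * t) * a) := by
  have hexp := ((NormedSpace.expSeries_div_hasSum_exp (Λ * t)).mul_right a).mul_left
    (Real.exp (-c * t))
  rw [← Real.exp_eq_exp_ℝ, ← mul_assoc, ← Real.exp_add] at hexp
  convert! hexp using 2
  · rw [mul_pow]
    field_simp
  · ring_nf

theorem tendsto_semigroup_apply_of_eigenfunction (hlam : 0 ≤ lam) (hκ : 0 ≤ κ) (hγ : 0 ≤ γ)
    {φ : State → ℝ} {Λ : ℝ} (heig : gain lam κ γ φ = Λ • φ) {f : ℕ → State →ᵇ ℝ}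
    (hf0 : ∀ N, 0 ≤ ⇑(f N)) (hfφ : ∀ N, ⇑(f N) ≤ φ)
    (hf : Tendsto (fun N => ⇑(f N)) atTop (𝓝 φ)) (t : ℝ≥0) (p : State) :
    Tendsto (fun N => semigroup lam κ γ t (f N) p) atTop
      (𝓝 (Real.exp ((Λ - (lam + 2 * κ + γ)) * t) * φ p)) := by
  have hmono (n : ℕ) : Monotone (gain lam κ γ)^[n] := (gain_mono hlam hκ hγ).iterate n
  have hnonneg (N n : ℕ) : 0 ≤ (gain lam κ γ)^[n] (f N) p := by
    have hzero : (gain lam κ γ)^[n] 0 = 0 :=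
      Function.iterate_fixed (by ext; simp [gain]) n
    exact (congrFun hzero p).symm.trans_le (hmono n (hf0 N) p)
  have hle (N n : ℕ) : (gain lam κ γ)^[n] (f N) p ≤ Λ ^ n * φ p :=
    (hmono n (hfφ N) p).trans_eq (congrFun (iterate_gain_of_eigenfunction heig n) p)
  have hlim (n : ℕ) :
      Tendsto (fun N => (gain lam κ γ)^[n] (f N) p) atTop (𝓝 (Λ ^ n * φ p)) := by
    have hcont := ((continuous_gain (lam := lam) (κ := κ) (γ := γ)).iterate n).tendsto φ
    rw [iterate_gain_of_eigenfunction heig] at hcont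
    exact (tendsto_pi_nhds.1 (hcont.comp hf)) p
  have hsum := hasSum_exp_mul_inv_factorial_mul_pow Λ (lam + 2 * κ + γ) t (φ p)
  rw [← hsum.tsum_eq]
  simp_rw [← (hasSum_semigroup_apply t (f _) p).tsum_eq]
  refine tendsto_tsum_of_dominated_convergence hsum.summable
    (fun n => ((hlim n).const_mul _).const_mul _) (Eventually.of_forall fun N n => ?_)
  have := hnonneg N n
  rw [Real.norm_of_nonneg (by positivity)]
  gcongr
  exact hle N n

theorem exists_monotone_tendsto_boundedContinuousFunction {S : Type*} [TopologicalSpace S]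
    [DiscreteTopology S] {φ : S → ℝ} (hφ : 0 ≤ φ) :
    ∃ f : ℕ → S →ᵇ ℝ, (∀ N, 0 ≤ ⇑(f N)) ∧ (∀ N, ⇑(f N) ≤ φ) ∧ Monotone (fun N => ⇑(f N)) ∧
      Tendsto (fun N => ⇑(f N)) atTop (𝓝 φ) := by
  have hmem (N : ℕ) (p : S) : 0 ≤ min (φ p) N := le_min (hφ p) N.cast_nonneg
  refine ⟨fun N => .ofNormedAddCommGroupDiscrete (fun p => min (φ p) N) N fun p => ?_,
    fun N p => hmem N p, fun N p => min_le_left _ _, fun M N hMN p => ?_,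
    tendsto_pi_nhds.2 fun p => tendsto_const_nhds.congr' ?_⟩
  · rw [Real.norm_of_nonneg (hmem N p)]
    exact min_le_right _ _
  · exact min_le_min_left _ (Nat.cast_le.2 hMN)
  · filter_upwards [eventually_ge_atTop ⌈φ p⌉₊] with N hN
    exact (min_eq_left (Nat.ceil_le.1 hN)).symm

end Semigroup

/-! ### Expectations of eigenfunctions -/

section Moments

instance {M : Type*} [Monoid M] [MeasurableSpace M] [MeasurableSingletonClass M] :
    MeasurableSingletonClass Mˣ where
  measurableSet_singleton v :=
    ⟨{(v : M)}, measurableSet_singleton _, by ext u; exact Units.val_inj⟩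

variable {Ω : Type*} [mΩ : MeasurableSpace Ω] {μ : Measure Ω} {ℱ : Filtration ℝ≥0 mΩ}
  {X : ℝ≥0 → Ω → ℤ} {V : ℝ≥0 → Ω → ℤˣ} {lam κ γ : ℝ}

namespace IsRunAndTumble

theorem measurable_state (h : IsRunAndTumble lam κ γ ℱ X V μ) (t : ℝ≥0) :
    Measurable fun ω => (X t ω, V t ω) :=
  ((h.measurable_position t).mono (ℱ.le t) le_rfl).prodMk
    ((h.measurable_velocity t).mono (ℱ.le t) le_rfl)

variable [IsFiniteMeasure μ]

theorem integral_velocity_zero (h : IsRunAndTumble lam κ γ ℱ X V μ) (g : ℤˣ → ℝ) :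
    ∫ ω, g (V 0 ω) ∂μ = (g 1 + g (-1)) / 2 := by
  have hV : Measurable (V 0) := measurable_snd.comp (h.measurable_state 0)
  have hlaw (v : ℤˣ) : (μ.map (V 0)) {v} = 1 / 2 := by
    rw [Measure.map_apply hV (measurableSet_singleton v)]
    exact h.velocity_zero v
  rw [← integral_map (f := g) hV.aemeasurable (measurable_of_countable g).aestronglyMeasurable,
    integral_fintype .of_finite, UnitsInt.univ, Finset.sum_pair (by decide)]
  simp only [measureReal_def, hlaw, one_div, ENNReal.toReal_inv, ENNReal.toReal_ofNat, smul_eq_mul]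
  ring

theorem integral_comp_state (h : IsRunAndTumble lam κ γ ℱ X V μ) (t : ℝ≥0) (f : State →ᵇ ℝ) :
    ∫ ω, f (X t ω, V t ω) ∂μ
      = (semigroup lam κ γ t f (0, 1) + semigroup lam κ γ t f (0, -1)) / 2 := by
  have hmarkov := h.markov 0 t f
  rw [zero_add] at hmarkov
  rw [← h.integral_velocity_zero fun v => semigroup lam κ γ t f (0, v),
    ← integral_condExp (ℱ.le 0), integral_congr_ae hmarkov]
  refine integral_congr_ae ?_
  filter_upwards [h.position_zero] with ω hω
  rw [hω]

theorem lintegral_eigenfunction (h : IsRunAndTumble lam κ γ ℱ X V μ) (hlam : 0 ≤ lam)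
    (hκ : 0 ≤ κ) (hγ : 0 ≤ γ) {φ : State → ℝ} {Λ : ℝ} (hφ : 0 ≤ φ)
    (heig : gain lam κ γ φ = Λ • φ) (t : ℝ≥0) :
    ∫⁻ ω, ENNReal.ofReal (φ (X t ω, V t ω)) ∂μ = ENNReal.ofReal
      (Real.exp ((Λ - (lam + 2 * κ + γ)) * t) * ((φ (0, 1) + φ (0, -1)) / 2)) := by
  obtain ⟨f, hf0, hfφ, hfmono, hf⟩ := exists_monotone_tendsto_boundedContinuousFunction hφ
  have hmeas (N : ℕ) : Measurable fun ω => f N (X t ω, V t ω) :=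
    (measurable_of_countable (f N)).comp (h.measurable_state t)
  have hleft : Tendsto (fun N => ∫⁻ ω, ENNReal.ofReal (f N (X t ω, V t ω)) ∂μ) atTop
      (𝓝 (∫⁻ ω, ENNReal.ofReal (φ (X t ω, V t ω)) ∂μ)) :=
    lintegral_tendsto_of_tendsto_of_monotone (fun N => (hmeas N).ennreal_ofReal.aemeasurable)
      (ae_of_all _ fun ω M N hMN => ENNReal.ofReal_le_ofReal (hfmono hMN _))
      (ae_of_all _ fun ω => ENNReal.tendsto_ofReal (tendsto_pi_nhds.1 hf _))
  have hright := (tendsto_semigroup_apply_of_eigenfunction hlam hκ hγ heig hf0 hfφ hf t (0, 1)).add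
    (tendsto_semigroup_apply_of_eigenfunction hlam hκ hγ heig hf0 hfφ hf t (0, -1))
  rw [← mul_add] at hright
  have hagree (N : ℕ) : ∫⁻ ω, ENNReal.ofReal (f N (X t ω, V t ω)) ∂μ = ENNReal.ofReal
      ((semigroup lam κ γ t (f N) (0, 1) + semigroup lam κ γ t (f N) (0, -1)) / 2) := by
    rw [← h.integral_comp_state, ofReal_integral_eq_lintegral_ofReal]
    · exact .of_bound (hmeas N).aestronglyMeasurable ‖f N‖
        (ae_of_all _ fun ω => (f N).norm_coe_le_norm _)
    · exact ae_of_all _ fun ω => hf0 N _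
  simp_rw [hagree] at hleft
  rw [← mul_div_assoc]
  exact tendsto_nhds_unique hleft (ENNReal.tendsto_ofReal (hright.div_const 2))

theorem integrable_eigenfunction (h : IsRunAndTumble lam κ γ ℱ X V μ) (hlam : 0 ≤ lam)
    (hκ : 0 ≤ κ) (hγ : 0 ≤ γ) {φ : State → ℝ} {Λ : ℝ} (hφ : 0 ≤ φ)
    (heig : gain lam κ γ φ = Λ • φ) (t : ℝ≥0) :
    Integrable (fun ω => φ (X t ω, V t ω)) μ := by
  refine ⟨((measurable_of_countable φ).comp (h.measurable_state t)).aestronglyMeasurable, ?_⟩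
  rw [hasFiniteIntegral_iff_ofReal (ae_of_all _ fun ω => hφ (X t ω, V t ω)),
    h.lintegral_eigenfunction hlam hκ hγ hφ heig]
  exact ENNReal.ofReal_lt_top

theorem integral_eigenfunction (h : IsRunAndTumble lam κ γ ℱ X V μ) (hlam : 0 ≤ lam)
    (hκ : 0 ≤ κ) (hγ : 0 ≤ γ) {φ : State → ℝ} {Λ : ℝ} (hφ : 0 ≤ φ)
    (heig : gain lam κ γ φ = Λ • φ) (t : ℝ≥0) :
    ∫ ω, φ (X t ω, V t ω) ∂μ
      = Real.exp ((Λ - (lam + 2 * κ + γ)) * t) * ((φ (0, 1) + φ (0, -1)) / 2) := by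
  have hstart : 0 ≤ φ (0, 1) + φ (0, -1) := add_nonneg (hφ _) (hφ _)
  rw [integral_eq_lintegral_of_nonneg_ae (ae_of_all _ fun ω => hφ (X t ω, V t ω))
    (h.integrable_eigenfunction hlam hκ hγ hφ heig t).aestronglyMeasurable,
    h.lintegral_eigenfunction hlam hκ hγ hφ heig, ENNReal.toReal_ofReal (by positivity)]

end IsRunAndTumble

end Moments

/-! ### The Perron eigenfunction -/

section FreeEnergy

variable {lam κ γ : ℝ}

/-- For `b = lam sinh α` and `s = √(γ² + b²)`, the vector `v ↦ s + v b + γ`. It is an eigenvector of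
`!![b, γ; γ, -b]` for the larger eigenvalue `s`, and this normalization is positive for `γ > 0`,
whatever the sign of `b`. -/
noncomputable def perronVector (lam γ α : ℝ) (v : ℤˣ) : ℝ :=
  √(γ ^ 2 + lam ^ 2 * Real.sinh α ^ 2) + (v : ℤ) * (lam * Real.sinh α) + γ

theorem perronVector_eigenvector (lam γ α : ℝ) (v : ℤˣ) :
    (v : ℤ) * (lam * Real.sinh α) * perronVector lam γ α v + γ * perronVector lam γ α (-v)
      = √(γ ^ 2 + lam ^ 2 * Real.sinh α ^ 2) * perronVector lam γ α v := by
  have hsqrt : √(γ ^ 2 + lam ^ 2 * Real.sinh α ^ 2) ^ 2 = γ ^ 2 + lam ^ 2 * Real.sinh α ^ 2 :=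
    Real.sq_sqrt (by positivity)
  have hv : ((v : ℤ) : ℝ) ^ 2 = 1 := by rcases Int.units_eq_one_or v with rfl | rfl <;> simp
  simp only [perronVector, Units.val_neg, Int.cast_neg]
  linear_combination (lam * Real.sinh α) ^ 2 * hv - hsqrt

theorem perronVector_mem_Icc (lam γ α : ℝ) (v : ℤˣ) :
    perronVector lam γ α v ∈ Set.Icc γ (2 * √(γ ^ 2 + lam ^ 2 * Real.sinh α ^ 2) + γ) := by
  have habs : |(v : ℤ) * (lam * Real.sinh α)| ≤ √(γ ^ 2 + lam ^ 2 * Real.sinh α ^ 2) := by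
    have hv : |((v : ℤ) : ℝ)| = 1 := by rcases Int.units_eq_one_or v with rfl | rfl <;> simp
    rw [abs_mul, hv, one_mul]
    exact Real.abs_le_sqrt (by nlinarith)
  unfold perronVector
  constructor <;> linarith [abs_le.1 habs]

/-- The positive eigenfunction `(x, v) ↦ e^{α x} g v` of the generator with eigenvalue
`freeEnergy lam κ γ α`, for `g` the Perron vector. -/
noncomputable def perronFunction (lam γ α : ℝ) (p : State) : ℝ :=
  Real.exp (α * p.1) * perronVector lam γ α p.2

theorem gain_perronFunction (lam κ γ α : ℝ) :
    gain lam κ γ (perronFunction lam γ α)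
      = (freeEnergy lam κ γ α + (lam + 2 * κ + γ)) • perronFunction lam γ α := by
  ext ⟨x, v⟩
  have hv : Real.exp (α * (v : ℤ)) = Real.cosh α + (v : ℤ) * Real.sinh α := by
    rcases Int.units_eq_one_or v with rfl | rfl
    · simp [Real.cosh_add_sinh]
    · simp [← Real.cosh_sub_sinh, sub_eq_add_neg]
  simp only [gain, perronFunction, freeEnergy, Pi.smul_apply, smul_eq_mul, Int.cast_add,
    Int.cast_sub, Int.cast_one, mul_add, mul_sub, mul_one, Real.exp_add, Real.exp_sub, hv]
  rw [div_eq_mul_inv, ← Real.exp_neg, ← Real.cosh_add_sinh α, ← Real.cosh_sub_sinh α]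
  linear_combination Real.exp (α * x) * perronVector_eigenvector lam γ α v

theorem differentiable_freeEnergy (hγ : γ ≠ 0) (lam κ : ℝ) :
    Differentiable ℝ (freeEnergy lam κ γ) := by
  unfold freeEnergy
  intro α
  have : γ ^ 2 + lam ^ 2 * Real.sinh α ^ 2 ≠ 0 := by positivity
  fun_prop (disch := assumption)

theorem perronFunction_nonneg (hγ : 0 ≤ γ) (lam α : ℝ) : 0 ≤ perronFunction lam γ α :=
  fun p => mul_nonneg (Real.exp_nonneg _) (hγ.trans (perronVector_mem_Icc lam γ α p.2).1)

variable {Ω : Type*} [mΩ : MeasurableSpace Ω] {μ : Measure Ω} [IsFiniteMeasure μ]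
  {ℱ : Filtration ℝ≥0 mΩ} {X : ℝ≥0 → Ω → ℤ} {V : ℝ≥0 → Ω → ℤˣ}

namespace IsRunAndTumble

theorem integral_perronFunction (h : IsRunAndTumble lam κ γ ℱ X V μ) (hlam : 0 ≤ lam)
    (hκ : 0 ≤ κ) (hγ : 0 ≤ γ) (α : ℝ) (t : ℝ≥0) :
    ∫ ω, perronFunction lam γ α (X t ω, V t ω) ∂μ
      = Real.exp (freeEnergy lam κ γ α * t) * (√(γ ^ 2 + lam ^ 2 * Real.sinh α ^ 2) + γ) := by
  rw [h.integral_eigenfunction hlam hκ hγ (perronFunction_nonneg hγ lam α)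
    (gain_perronFunction lam κ γ α), add_sub_cancel_right]
  congr 1
  simp only [perronFunction, perronVector, Int.cast_zero, mul_zero, Real.exp_zero, Units.val_one,
    Units.val_neg, Int.cast_one, Int.cast_neg]
  ring

theorem integrable_exp_mul_position (h : IsRunAndTumble lam κ γ ℱ X V μ) (hlam : 0 ≤ lam)
    (hκ : 0 ≤ κ) (hγ : 0 < γ) (α : ℝ) (t : ℝ≥0) :
    Integrable (fun ω => Real.exp (α * (X t ω : ℝ))) μ := by
  have hφ := h.integrable_eigenfunction hlam hκ hγ.le (perronFunction_nonneg hγ.le lam α)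
    (gain_perronFunction lam κ γ α) t
  have hmeas : Measurable fun ω => Real.exp (α * (X t ω : ℝ)) :=
    (measurable_of_countable fun p : State => Real.exp (α * (p.1 : ℝ))).comp (h.measurable_state t)
  refine (hφ.div_const γ).mono' hmeas.aestronglyMeasurable (ae_of_all _ fun ω => ?_)
  rw [Real.norm_of_nonneg (Real.exp_nonneg _), le_div_iff₀ hγ]
  exact mul_le_mul_of_nonneg_left (perronVector_mem_Icc lam γ α _).1 (Real.exp_nonneg _)

theorem hasFreeEnergy (h : IsRunAndTumble lam κ γ ℱ X V μ) (hlam : 0 ≤ lam) (hκ : 0 ≤ κ)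
    (hγ : 0 < γ) : HasFreeEnergy μ (fun t ω => (X t ω : ℝ)) (freeEnergy lam κ γ) where
  integrable_exp_mul := h.integrable_exp_mul_position hlam hκ hγ
  tendsto_cgf α := by
    set s := √(γ ^ 2 + lam ^ 2 * Real.sinh α ^ 2)
    have : 0 ≤ s := Real.sqrt_nonneg _
    have hexp (t : ℝ≥0) := h.integrable_exp_mul_position hlam hκ hγ α t
    have hφ (t : ℝ≥0) := h.integrable_eigenfunction hlam hκ hγ.le
      (perronFunction_nonneg hγ.le lam α) (gain_perronFunction lam κ γ α) t
    have hE (t : ℝ≥0) := h.integral_perronFunction hlam hκ hγ.le α t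
    refine tendsto_one_div_mul_cgf_of_mgf_bounds (c := (s + γ) / (2 * s + γ)) (C := (s + γ) / γ)
      (by positivity) (fun t => ?_) fun t => ?_
    · rw [div_mul_eq_mul_div, div_le_iff₀ (by positivity), mul_comm (s + γ), ← hE, mgf,
        ← integral_mul_const]
      exact integral_mono (hφ t) ((hexp t).mul_const _) fun ω =>
        mul_le_mul_of_nonneg_left (perronVector_mem_Icc lam γ α _).2 (Real.exp_nonneg _)
    · rw [div_mul_eq_mul_div, le_div_iff₀ hγ, mul_comm (s + γ), ← hE, mgf, ← integral_mul_const]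
      exact integral_mono ((hexp t).mul_const _) (hφ t) fun ω =>
        mul_le_mul_of_nonneg_left (perronVector_mem_Icc lam γ α _).1 (Real.exp_nonneg _)

end IsRunAndTumble

end FreeEnergy

/-! ### Eigenvalues of the Fourier matrix -/

section FourierMatrix

theorem hasEigenvalue_toLin'_add_sub_iff {K : Type*} [Field K] {a b c s : K}
    (hs : s ^ 2 = b ^ 2 + c ^ 2) (z : K) :
    Module.End.HasEigenvalue (Matrix.toLin' !![a + b, c; c, a - b]) z ↔ z = a + s ∨ z = a - s := by
  have hcharpoly : (z - (a + s)) * (z - (a - s))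
      = z ^ 2 - (a + b + (a - b)) * z + ((a + b) * (a - b) - c * c) := by
    linear_combination -hs
  rw [Module.End.hasEigenvalue_iff_isRoot_charpoly, Matrix.charpoly_toLin', Matrix.charpoly_fin_two,
    ← sub_eq_zero, ← sub_eq_zero (b := a - s), ← mul_eq_zero, hcharpoly]
  simp [Matrix.trace_fin_two, Matrix.det_fin_two]

theorem fourierMatrix_neg_I_mul (lam κ γ α : ℝ) :
    fourierMatrix lam κ γ (-Complex.I * (α : ℂ)) =
      !![(2 * κ + lam) * (Complex.cosh α - 1) - γ + lam * Complex.sinh α, (γ : ℂ);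
        (γ : ℂ), (2 * κ + lam) * (Complex.cosh α - 1) - γ - lam * Complex.sinh α] := by
  have hcos : Complex.cos (-Complex.I * α) = Complex.cosh α := by
    rw [neg_mul, Complex.cos_neg, mul_comm, Complex.cos_mul_I]
  have hsin : Complex.I * lam * Complex.sin (-Complex.I * α) = lam * Complex.sinh α := by
    rw [neg_mul, Complex.sin_neg, mul_comm Complex.I (α : ℂ), Complex.sin_mul_I]
    linear_combination (-(lam * Complex.sinh α)) * Complex.I_mul_I
  rw [fourierMatrix, hcos, hsin]

theorem hasEigenvalue_fourierMatrix_iff (lam κ γ α : ℝ) (z : ℂ) :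
    Module.End.HasEigenvalue
        (Matrix.toLin' (fourierMatrix lam κ γ (-Complex.I * (α : ℂ)))) z ↔
      z = (freeEnergy lam κ γ α : ℝ) ∨
        z = ((freeEnergy lam κ γ α - 2 * √(γ ^ 2 + lam ^ 2 * Real.sinh α ^ 2) : ℝ) : ℂ) := by
  have hsqrt : ((√(γ ^ 2 + lam ^ 2 * Real.sinh α ^ 2) : ℝ) : ℂ) ^ 2
      = (lam * Complex.sinh α) ^ 2 + (γ : ℂ) ^ 2 := by
    rw [← Complex.ofReal_pow, Real.sq_sqrt (by positivity)]
    push_cast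
    ring
  rw [fourierMatrix_neg_I_mul, hasEigenvalue_toLin'_add_sub_iff hsqrt]
  refine or_congr ?_ ?_ <;>
  · simp only [freeEnergy]
    push_cast
    ring_nf

end FourierMatrix

end RunTumble

theorem mainTheorem1 {Ω : Type*} [mΩ : MeasurableSpace Ω] (μ : Measure Ω) [IsProbabilityMeasure μ]
    (ℱ : Filtration ℝ≥0 mΩ) (X : ℝ≥0 → Ω → ℤ) (V : ℝ≥0 → Ω → ℤˣ)
    (lam κ γ : ℝ) (hlam : 0 ≤ lam) (hκ : 0 ≤ κ) (hγ : 0 < γ)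
    (hXV : RunTumble.IsRunAndTumble lam κ γ ℱ X V μ) :
    RunTumble.SatisfiesLDP μ (fun t ω => (X t ω : ℝ) / (t : ℝ))
        (RunTumble.legendre (RunTumble.freeEnergy lam κ γ)) ∧
      (∀ α : ℝ,
        (∀ t : ℝ≥0, Integrable (fun ω => Real.exp (α * (X t ω : ℝ))) μ) ∧
        Tendsto (fun t : ℝ≥0 => 1 / (t : ℝ) * Real.log (∫ ω, Real.exp (α * (X t ω : ℝ)) ∂μ)) atTop
          (𝓝 (RunTumble.freeEnergy lam κ γ α))) ∧
      (∀ α : ℝ,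
        Module.End.HasEigenvalue
          (Matrix.toLin' (RunTumble.fourierMatrix lam κ γ (-Complex.I * (α : ℂ))))
          ((RunTumble.freeEnergy lam κ γ α : ℝ) : ℂ) ∧
        ∀ z : ℂ,
          Module.End.HasEigenvalue
            (Matrix.toLin' (RunTumble.fourierMatrix lam κ γ (-Complex.I * (α : ℂ)))) z →
          z.im = 0 ∧ z.re ≤ RunTumble.freeEnergy lam κ γ α) := by
  have h := hXV.hasFreeEnergy hlam hκ hγ
  refine ⟨h.satisfiesLDP (RunTumble.differentiable_freeEnergy hγ.ne' lam κ),
    fun α => ⟨h.integrable_exp_mul α, h.tendsto_cgf α⟩,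
    fun α => ⟨(RunTumble.hasEigenvalue_fourierMatrix_iff lam κ γ α _).2 (Or.inl rfl),
      fun z hz => ?_⟩⟩
  rcases (RunTumble.hasEigenvalue_fourierMatrix_iff lam κ γ α z).1 hz with rfl | rfl <;> simp
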